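/- **Setting.** Let $E$ be a nonzero real Banach space with norm dual $E^*$ and bidual $E^{**}$, let $q(x,x^*):=\langle x,x^*\rangle$ on $E\times E^*$, and let $f\colon E\times E^*\to\,]-\infty,\infty]$ be proper, convex and (norm) lower semicontinuous. Write $\operatorname{dom}f:=\{b\colon f(b)\in\mathbb R\}$ and $\mathcal M f:=\{(x,x^*)\in E\times E^*\colon f(x,x^*)=\langle x,x^*\rangle\}$. A *special norm* on $E\times E^*$ is one of $\|(x,x^*)\|_{1,\tau}=\frac1{\sqrt2}(\tau\|x\|+\|x^*\|/\tau)$, $\|(x,x^*)\|_{2,\tau}=\sqrt{\tau^2\|x\|^2+\|x^*\|^2/\tau^2}$, $\|(x,x^*)\|_{\infty,\tau}=\sqrt2\max(\tau\|x\|,\|x^*\|/\tau)$ with $\tau>0$. We say that $f$ is *VZ with respect to a special norm* $\|\cdot\|$ if, with $p:=\frac12\|\cdot\|^2+q$, $\inf_{b\in E\times E^*}\big[(f-q)(b)+p(c-b)\big]=0$ for every $c\in E\times E^*$; $f$ is a *VZ function* if this holds for some special norm. We say that $f$ is a *MAS function* if $f(x,x^*)\ge\langle x,x^*\rangle$ on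 $E\times E^*$ and $\sup_{(x,x^*)\in E\times E^*}\big[\langle x,y^*\rangle+\langle x^*,y^{**}\rangle-f(x,x^*)\big]\ge\langle y^*,y^{**}\rangle$ for all $(y^{**},y^*)\in E^{**}\times E^*$. A set $A\subset E\times E^*$ is *monotone* if $\langle x-y,x^*-y^*\rangle\ge0$ for all $(x,x^*),(y,y^*)\in A$, and *maximally monotone* if it is monotone and not properly contained in another monotone set. $A$ is *of type (ANA)* if for each $(x,x^*)\in (E\times E^*)\setminus A$ there are $(y_n,y_n^*)\in A$ with $y_n\ne x$, $y_n^*\ne x^*$ and $\frac{\langle y_n-x,y_n^*-x^*\rangle}{\|y_n-x\|\|y_n^*-x^*\|}\to-1$. $A$ is *of type (BR)* if, whenever $(x,x^*)\in E\times E^*$, $\alpha,\beta>0$ and $\inf_{(y,y^*)\in A}\langle y-x,y^*-x^*\rangle>-\alpha\beta$, there is $(y,y^*)\in A$ with $\|y-x\|<\alpha$ and $\|y^*-x^*\|<\beta$. **Theorem 5.5.** The following are equivalent: $f$ is VZ with respect to some special norm; $f$ is VZ with respect to every special norm; $f$ is a MAS function. If $f$ satisfies these conditions, then: (a) $\mathcal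 M f$ is a maximally monotone subset of $E\times E^*$. (b) For all $(x,x^*)\in E\times E^*$ and $\alpha,\beta>0$ there is a unique $\omega\ge0$ for which there exists a bounded sequence $\{(y_n,y_n^*)\}_{n\ge1}$ in $\mathcal M f$ such that $\lim_n\|y_n-x\|=\alpha\omega$, $\lim_n\|y_n^*-x^*\|=\beta\omega$ and $\lim_n\langle y_n-x,y_n^*-x^*\rangle=-\alpha\beta\omega^2$. (c) For all $(x,x^*)\in (E\times E^*)\setminus\mathcal M f$ and $\alpha,\beta>0$ there is a bounded sequence $\{(y_n,y_n^*)\}_{n\ge1}$ in $\mathcal M f\cap[(E\setminus\{x\})\times(E^*\setminus\{x^*\})]$ such that $$\lim_{n\to\infty}\frac{\|y_n-x\|}{\|y_n^*-x^*\|}=\frac\alpha\beta\quad\text{and}\quad\lim_{n\to\infty}\frac{\langle y_n-x,y_n^*-x^*\rangle}{\|y_n-x\|\,\|y_n^*-x^*\|}=-1.\qquad(*)$$ In particular, $\mathcal M f$ is of type (ANA). (d) If $(x,x^*)\in (E\times E^*)\setminus\mathcal M f$, $\alpha,\beta>0$ and $\inf_{(y,y^*)\in\mathcal M f}\langle y-x,y^*-x^*\rangle>-\alpha\beta$,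 then there is a bounded sequence $\{(y_n,y_n^*)\}_{n\ge1}$ in $\mathcal M f\cap[(E\setminus\{x\})\times(E^*\setminus\{x^*\})]$ satisfying $(*)$ for which the limits $\lim_n\|y_n-x\|$ and $\lim_n\|y_n^*-x^*\|$ exist and satisfy $\lim_n\|y_n-x\|<\alpha$ and $\lim_n\|y_n^*-x^*\|<\beta$. In particular, $\mathcal M f$ is of type (BR). (e) If $(x,x^*)\in (E\times E^*)\setminus\mathcal M f$, $\alpha,\beta>0$ and $f(x,x^*)<\langle x,x^*\rangle+\alpha\beta$, then there is a sequence with all the properties of the sequence in (d). (f) With $\pi_E(x,x^*):=x$ and $\pi_{E^*}(x,x^*):=x^*$, we have $\overline{\pi_E(\mathcal M f)}=\overline{\pi_E(\operatorname{dom}f)}$ and $\overline{\pi_{E^*}(\mathcal M f)}=\overline{\pi_{E^*}(\operatorname{dom}f)}$ (norm closures). Consequently, $\overline{\pi_E(\mathcal M f)}$ and $\overline{\pi_{E^*}(\mathcal M f)}$ are convex. -/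

import Mathlib

open Filter Topology

noncomputable section

namespace VZ

/-- The product `E × E*` of a real normed space and its norm dual. -/
abbrev Phase (E : Type*) [NormedAddCommGroup E] [NormedSpace ℝ E] : Type _ :=
  E × StrongDual ℝ E

section Functions

variable {X : Type*} [AddCommGroup X] [Module ℝ X]

/-- The effective domain: the points at which the extended-real-valued function is finite. -/
def dom (f : X → EReal) : Set X := {b | ∃ r : ℝ, f b = (r : EReal)}

/-- `f` is a proper convex function with values in `]-∞, ∞]`. -/
structure IsProperConvex (f : X → EReal) : Prop where
  ne_bot : ∀ b, f b ≠ ⊥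
  proper : (dom f).Nonempty
  convex : ∀ b c : X, ∀ s t : ℝ, 0 < s → 0 < t → s + t = 1 →
    f (s • b + t • c) ≤ (s : EReal) * f b + (t : EReal) * f c

/-- `f` is a proper, convex, lower semicontinuous function with values in `]-∞, ∞]`. -/
def IsPCLSC [TopologicalSpace X] (f : X → EReal) : Prop :=
  IsProperConvex f ∧ LowerSemicontinuous f

/-- The inf-convolution `(h ∇ k)(x) = inf_y [h(y) + k(x - y)]`. -/
def infConv (h k : X → EReal) (x : X) : EReal := ⨅ y, h y + k (x - y)

end Functions

variable {E : Type*} [NormedAddCommGroup E] [NormedSpace ℝ E]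

/-- The quadratic form `q(x, x*) = ⟨x, x*⟩` on `E × E*`. -/
def q (b : Phase E) : ℝ := b.2 b.1

/-- `‖(x, x*)‖_{1,τ} = (τ‖x‖ + ‖x*‖/τ) / √2`. -/
def normOne (τ : ℝ) (b : Phase E) : ℝ := (τ * ‖b.1‖ + ‖b.2‖ / τ) / √2

/-- `‖(x, x*)‖_{2,τ} = √(τ²‖x‖² + ‖x*‖²/τ²)`. -/
def normTwo (τ : ℝ) (b : Phase E) : ℝ := √(τ ^ 2 * ‖b.1‖ ^ 2 + ‖b.2‖ ^ 2 / τ ^ 2)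

/-- `‖(x, x*)‖_{∞,τ} = √2 (τ‖x‖ ∨ ‖x*‖/τ)`. -/
def normInf (τ : ℝ) (b : Phase E) : ℝ := √2 * max (τ * ‖b.1‖) (‖b.2‖ / τ)

/-- A special norm on `E × E*`: one of the three norms above, for some `τ > 0`. -/
def IsSpecialNorm (N : Phase E → ℝ) : Prop :=
  ∃ τ : ℝ, 0 < τ ∧ (N = normOne τ ∨ N = normTwo τ ∨ N = normInf τ)

/-- `f` is a VZ function with respect to the norm `N`: with `p = N²/2 + q`, the
inf-convolution of `f - q` and `p` vanishes identically on `E × E*`. -/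
def IsVZWith (N : Phase E → ℝ) (f : Phase E → EReal) : Prop :=
  ∀ c : Phase E,
    infConv (fun b => f b - (q b : EReal)) (fun b => ((N b ^ 2 / 2 + q b : ℝ) : EReal)) c = 0

/-- `f` is a VZ function on `E × E*`: it is one with respect to some special norm. -/
def IsVZ (f : Phase E → EReal) : Prop := ∃ N, IsSpecialNorm N ∧ IsVZWith N f

/-- The Fenchel conjugate of `f` as a function on `(E × E*)* = E** × E*`:
`f*(y**, y*) = sup_{(x, x*)} [⟨x, y*⟩ + ⟨x*, y**⟩ - f(x, x*)]`. -/
def conj (f : Phase E → EReal) (d : StrongDual ℝ (StrongDual ℝ E) × StrongDual ℝ E) : EReal :=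
  ⨆ b : Phase E, ((d.2 b.1 + d.1 b.2 : ℝ) : EReal) - f b

/-- `f` is a MAS function: `f(x, x*) ≥ ⟨x, x*⟩` on `E × E*` and
`f*(y**, y*) ≥ ⟨y*, y**⟩` on `E** × E*`. -/
def IsMAS (f : Phase E → EReal) : Prop :=
  (∀ b, (q b : EReal) ≤ f b) ∧
    ∀ d : StrongDual ℝ (StrongDual ℝ E) × StrongDual ℝ E, ((d.1 d.2 : ℝ) : EReal) ≤ conj f d

/-- The set `M f = {(x, x*) : f(x, x*) = ⟨x, x*⟩}`. -/
def M (f : Phase E → EReal) : Set (Phase E) := {b | f b = (q b : EReal)}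

/-- `A ⊆ E × E*` is monotone: `⟨x - y, x* - y*⟩ ≥ 0` for all `(x, x*), (y, y*) ∈ A`. -/
def IsMonotone (A : Set (Phase E)) : Prop := ∀ b ∈ A, ∀ c ∈ A, 0 ≤ q (b - c)

/-- `A` is maximally monotone: it is monotone and not properly contained in a monotone set. -/
def IsMaximallyMonotone (A : Set (Phase E)) : Prop := Maximal IsMonotone A

/-- `y` is a bounded sequence in `A ∩ [(E ∖ {x}) × (E* ∖ {x*})]`, where `c = (x, x*)`, with
`‖yₙ - x‖ / ‖yₙ* - x*‖ → α / β` and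
`⟨yₙ - x, yₙ* - x*⟩ / (‖yₙ - x‖ ‖yₙ* - x*‖) → -1`. -/
structure IsNegAligned (A : Set (Phase E)) (c : Phase E) (α β : ℝ) (y : ℕ → Phase E) :
    Prop where
  bounded : Bornology.IsBounded (Set.range y)
  mem : ∀ n, y n ∈ A
  fst_ne : ∀ n, (y n).1 ≠ c.1
  snd_ne : ∀ n, (y n).2 ≠ c.2
  ratio : Tendsto (fun n => ‖(y n).1 - c.1‖ / ‖(y n).2 - c.2‖) atTop (𝓝 (α / β))
  aligned : Tendsto (fun n => q (y n - c) / (‖(y n).1 - c.1‖ * ‖(y n).2 - c.2‖)) atTop (𝓝 (-1))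

/-- Type (ANA): every point `(x, x*)` outside `A` is almost negatively aligned with points
`(yₙ, yₙ*)` of `A` such that `yₙ ≠ x` and `yₙ* ≠ x*`. -/
def IsTypeANA (A : Set (Phase E)) : Prop :=
  ∀ c : Phase E, c ∉ A → ∃ y : ℕ → Phase E,
    (∀ n, y n ∈ A ∧ (y n).1 ≠ c.1 ∧ (y n).2 ≠ c.2) ∧
    Tendsto (fun n => q (y n - c) / (‖(y n).1 - c.1‖ * ‖(y n).2 - c.2‖)) atTop (𝓝 (-1))

/-- `inf_{(y, y*) ∈ A} ⟨y - x, y* - x*⟩` for `c = (x, x*)`, in the extended reals. -/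
def infQ (A : Set (Phase E)) (c : Phase E) : EReal := ⨅ b ∈ A, (q (b - c) : EReal)

/-- Type (BR), the Brøndsted–Rockafellar property. -/
def IsTypeBR (A : Set (Phase E)) : Prop :=
  ∀ c : Phase E, ∀ α β : ℝ, 0 < α → 0 < β → ((-(α * β) : ℝ) : EReal) < infQ A c →
    ∃ b ∈ A, ‖b.1 - c.1‖ < α ∧ ‖b.2 - c.2‖ < β

end VZ

end

open VZ

/-!
Write `p = ½‖·‖² + q` for a special norm. The identity
`(f - q)(b) + p(c - b) = f(b) - ⟨b, c⟩ + ½‖c - b‖² + q(c)`, with `⟨b, c⟩` the bilinear form polar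
to `q`, makes the VZ condition a statement about the infimum of a convex function.

*Equivalences.* The three kinds of special norm with a given `τ` are ordered, so VZ for any of them
gives almost-minimizers for the smallest, `‖·‖_{1,τ}` (`HasApprox`). Pairing these with a point of
`E** × E*`, after a shift that makes the bidual part almost norm-attaining, yields `f* ≥ q̃`
(`HasApprox.isMAS`). Conversely, if the infimum for the largest norm `‖·‖_{∞,τ}` were positive, a
continuous affine function could be squeezed between `f` and a concave function
(`exists_affine_between`), and its slope would violate `f* ≥ q̃` (`IsMAS.exists_approx`). Hence a
MAS function is VZ for every special norm.

*Consequences.* Convexity and `f ≥ q` give `-q(b - c) ≤ 2[(f - q)(b) + (f - q)(c)]`. So if `b` and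
`c` almost minimize and `p(b - c)` is small, then `‖b - c‖` is small; iterating almost-minimizers
produces a Cauchy sequence whose limit lies in `M f` by lower semicontinuity
(`HasApprox.exists_mem_M_dist_le`). It follows that each `c` admits a bounded sequence `yₙ` in `M f`
with `p(yₙ - c) → 0` (`HasApprox.exists_seq`), which gives maximality at once. Since
`(τ‖x‖ - ‖x*‖/τ)²/4 ≤ p(x, x*)`, the choice `τ = √(β/α)` and a subsequence give the number `ω`
(`HasApprox.exists_isNegAlignedAt`); monotonicity makes it unique. The other assertions are read
off from `ω`: it is positive for `c ∉ M f` as `M f` is closed, and it is less than `1` when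
`q(y - c)` is bounded below on `M f` by more than `-αβ`, which holds if `f(c) < q(c) + αβ`.
-/

open Filter Topology
namespace VZ

variable {E : Type*} [NormedAddCommGroup E] [NormedSpace ℝ E]

/-! ### The quadratic form and the special norms -/

lemma abs_q_le (b : Phase E) : |q b| ≤ ‖b.1‖ * ‖b.2‖ := by
  rw [mul_comm]
  exact b.2.le_opNorm b.1

lemma q_add (b c : Phase E) : q (b + c) = q b + (b.2 c.1 + c.2 b.1) + q c := by
  simp [q]; ring

lemma q_neg (b : Phase E) : q (-b) = q b := by simp [q]

lemma q_sub (b c : Phase E) : q (b - c) = q b - (b.2 c.1 + c.2 b.1) + q c := by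
  simp [q]; ring

lemma q_sub_comm (b c : Phase E) : q (b - c) = q (c - b) := by
  rw [← q_neg, neg_sub]

lemma continuous_q : Continuous (q : Phase E → ℝ) := by
  unfold q; fun_prop

/-- The weighted sum `τ‖x‖ + ‖x*‖/τ`, which is `√2` times the special norm `‖(x, x*)‖_{1,τ}`. -/
noncomputable def wsum (τ : ℝ) (b : Phase E) : ℝ := τ * ‖b.1‖ + ‖b.2‖ / τ

/-- The function `p = ½‖·‖² + q` for the special norm `‖·‖_{1,τ}`, the smallest of the three special
norms with parameter `τ`. -/
noncomputable def gap (τ : ℝ) (b : Phase E) : ℝ := wsum τ b ^ 2 / 4 + q b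

section Weighted

variable {τ : ℝ} (hτ : 0 < τ)
include hτ

lemma wsum_nonneg (b : Phase E) : 0 ≤ wsum τ b := by unfold wsum; positivity

lemma sub_sq_le_gap (b : Phase E) : (τ * ‖b.1‖ - ‖b.2‖ / τ) ^ 2 / 4 ≤ gap τ b := by
  have h := neg_le_of_abs_le (abs_q_le b)
  have h2 : (τ * ‖b.1‖) * (‖b.2‖ / τ) = ‖b.1‖ * ‖b.2‖ := by field_simp
  unfold gap wsum
  linarith

lemma gap_nonneg (b : Phase E) : 0 ≤ gap τ b := le_trans (by positivity) (sub_sq_le_gap hτ b)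

lemma wsum_add_le (b c : Phase E) : wsum τ (b + c) ≤ wsum τ b + wsum τ c := by
  have h1 := mul_le_mul_of_nonneg_left (norm_add_le b.1 c.1) hτ.le
  have h2 := div_le_div_of_nonneg_right (norm_add_le b.2 c.2) hτ.le
  simp only [wsum, Prod.fst_add, Prod.snd_add]
  rw [add_div] at h2
  linarith

lemma abs_polar_le (b c : Phase E) : |b.2 c.1 + c.2 b.1| ≤ wsum τ b * wsum τ c := by
  have h1 := b.2.le_opNorm c.1
  have h2 := c.2.le_opNorm b.1
  have h3 := abs_add_le (b.2 c.1) (c.2 b.1)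
  have h4 : wsum τ b * wsum τ c = ‖b.2‖ * ‖c.1‖ + ‖c.2‖ * ‖b.1‖
      + τ * ‖b.1‖ * (τ * ‖c.1‖) + ‖b.2‖ / τ * (‖c.2‖ / τ) := by
    unfold wsum; field_simp; ring
  have h5 : 0 ≤ τ * ‖b.1‖ * (τ * ‖c.1‖) := by positivity
  have h6 : 0 ≤ ‖b.2‖ / τ * (‖c.2‖ / τ) := by positivity
  rw [Real.norm_eq_abs] at h1 h2
  linarith

lemma abs_q_le_wsum (b : Phase E) : |q b| ≤ wsum τ b ^ 2 / 4 := by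
  have h2 : (τ * ‖b.1‖) * (‖b.2‖ / τ) = ‖b.1‖ * ‖b.2‖ := by field_simp
  unfold wsum
  nlinarith [abs_q_le b, sq_nonneg (τ * ‖b.1‖ - ‖b.2‖ / τ)]

lemma gap_add_le (b c : Phase E) :
    gap τ (b + c) ≤ gap τ b + 3 / 2 * (wsum τ b * wsum τ c) + wsum τ c ^ 2 / 2 := by
  have h1 := wsum_add_le hτ b c
  have h2 : wsum τ (b + c) ^ 2 ≤ (wsum τ b + wsum τ c) ^ 2 :=
    pow_le_pow_left₀ (wsum_nonneg hτ _) h1 2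
  have h3 := le_of_abs_le (abs_polar_le hτ b c)
  have h4 := le_of_abs_le (abs_q_le_wsum hτ c)
  unfold gap
  rw [q_add]
  linarith

lemma norm_le_wsum (b : Phase E) : ‖b‖ ≤ (τ + τ⁻¹) * wsum τ b := by
  have e : (τ + τ⁻¹) * wsum τ b
      = ‖b.1‖ + ‖b.2‖ + τ * (τ * ‖b.1‖) + τ⁻¹ * (τ⁻¹ * ‖b.2‖) := by
    unfold wsum; field_simp; ring
  have h1 : 0 ≤ τ * (τ * ‖b.1‖) := by positivity
  have h2 : 0 ≤ τ⁻¹ * (τ⁻¹ * ‖b.2‖) := by positivity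
  rw [e, Prod.norm_def]
  exact max_le (by linarith [norm_nonneg b.2]) (by linarith [norm_nonneg b.1])

lemma wsum_le_norm (b : Phase E) : wsum τ b ≤ (τ + τ⁻¹) * ‖b‖ := by
  have h1 := mul_le_mul_of_nonneg_left (norm_fst_le b) hτ.le
  have h2 := mul_le_mul_of_nonneg_left (norm_snd_le b) (inv_pos.2 hτ).le
  unfold wsum
  rw [add_mul, div_eq_inv_mul]
  linarith

end Weighted

/-- Half the square of a special norm lies between those of `‖·‖_{1,τ}` and `‖·‖_{∞,τ}`; the lower
bound is stated after adding `q`. -/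
lemma IsSpecialNorm.exists_bounds {N : Phase E → ℝ} (hN : IsSpecialNorm N) :
    ∃ τ : ℝ, 0 < τ ∧ N 0 = 0 ∧ ∀ b, gap τ b ≤ N b ^ 2 / 2 + q b ∧
      N b ^ 2 / 2 ≤ max (τ * ‖b.1‖) (‖b.2‖ / τ) ^ 2 := by
  obtain ⟨τ, hτ, h⟩ := hN
  refine ⟨τ, hτ, by rcases h with rfl | rfl | rfl <;> simp [normOne, normTwo, normInf],
    fun b => ?_⟩
  unfold gap
  have hA : 0 ≤ τ * ‖b.1‖ := by positivity
  have hB : 0 ≤ ‖b.2‖ / τ := by positivity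
  have s2 : √(2:ℝ) ^ 2 = 2 := Real.sq_sqrt (by norm_num)
  have key : (τ * ‖b.1‖) ^ 2 + (‖b.2‖ / τ) ^ 2
      ≤ 2 * max (τ * ‖b.1‖) (‖b.2‖ / τ) ^ 2 := by
    have h1 := pow_le_pow_left₀ hA (le_max_left (τ * ‖b.1‖) (‖b.2‖ / τ)) 2
    have h2 := pow_le_pow_left₀ hB (le_max_right (τ * ‖b.1‖) (‖b.2‖ / τ)) 2
    linarith
  have key2 := sq_nonneg (τ * ‖b.1‖ - ‖b.2‖ / τ)
  rcases h with rfl | rfl | rfl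
  · rw [normOne, div_pow, s2, wsum]
    constructor <;> linarith
  · rw [normTwo, Real.sq_sqrt (by positivity), wsum, ← mul_pow, ← div_pow]
    constructor <;> linarith
  · rw [normInf, mul_pow, s2, wsum]
    constructor <;> linarith

/-! ### Real-valued form of the VZ condition, and VZ functions are MAS functions -/

/-- The vanishing of `(f - q) ∇ p` in terms of real numbers: it splits into `q ≤ f`, seen by taking
`b = c`, and the existence of almost-minimizers. -/
lemma isVZWith_iff {f : Phase E → EReal} (hbot : ∀ b, f b ≠ ⊥) {N : Phase E → ℝ}
    (hN : ∀ b, 0 ≤ N b ^ 2 / 2 + q b) (h0 : N 0 = 0) :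
    IsVZWith N f ↔ (∀ b, (q b : EReal) ≤ f b) ∧ ∀ c, ∀ ε : ℝ, 0 < ε →
      ∃ b, ∃ r : ℝ, f b = r ∧ r - q b + (N (c - b) ^ 2 / 2 + q (c - b)) < ε := by
  constructor
  · intro h
    constructor
    · intro b
      have h1 := h b
      unfold infConv at h1
      have h2 := iInf_le (fun y => f y - (q y : EReal)
        + (((N (b - y)) ^ 2 / 2 + q (b - y) : ℝ) : EReal)) b
      rw [h1] at h2
      have h3 : (N (b - b)) ^ 2 / 2 + q (b - b) = 0 := by simp [h0, q]
      simp only [h3, EReal.coe_zero, add_zero] at h2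
      induction hfb : f b with
      | bot => exact absurd hfb (hbot b)
      | top => exact le_top
      | coe r =>
        rw [hfb] at h2
        norm_cast at h2 ⊢
        linarith
    · intro c ε hε
      have h1 := h c
      unfold infConv at h1
      have h2 : (⨅ y, (f y - (q y : EReal)
        + (((N (c - y)) ^ 2 / 2 + q (c - y) : ℝ) : EReal))) < (ε : EReal) := by
        rw [h1]; exact_mod_cast hε
      obtain ⟨b, hb⟩ := iInf_lt_iff.1 h2
      refine ⟨b, ?_⟩
      induction hfb : f b with
      | bot => exact absurd hfb (hbot b)
      | top =>
        rw [hfb, EReal.top_sub_coe, EReal.top_add_coe] at hb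
        exact absurd hb (by simp)
      | coe r =>
        rw [hfb] at hb
        exact ⟨r, rfl, by exact_mod_cast hb⟩
  · rintro ⟨h1, h2⟩ c
    unfold infConv
    apply le_antisymm
    · refine EReal.le_of_forall_lt_iff_le.1 fun ε hε => ?_
      obtain ⟨b, r, hb, hlt⟩ := h2 c ε (by exact_mod_cast hε)
      refine (iInf_le _ b).trans ?_
      beta_reduce
      rw [hb]
      exact_mod_cast hlt.le
    · refine le_iInf fun b => ?_
      beta_reduce
      have hb := h1 b
      induction hfb : f b with
      | bot => exact absurd hfb (hbot b)
      | top => rw [EReal.top_sub_coe, EReal.top_add_coe]; exact le_top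
      | coe r =>
        rw [hfb] at hb
        have := hN (c - b)
        norm_cast at hb ⊢
        linarith

/-- `f` is a VZ function for `‖·‖_{1,τ}`, in terms of real numbers. Being a VZ function for any
special norm with parameter `τ` implies this. -/
def HasApprox (τ : ℝ) (f : Phase E → EReal) : Prop :=
  ∀ c, ∀ ε : ℝ, 0 < ε → ∃ b, ∃ r : ℝ, f b = r ∧ r - q b + gap τ (c - b) < ε

lemma IsVZ.hasApprox {f : Phase E → EReal} (hbot : ∀ b, f b ≠ ⊥) (h : IsVZ f) :
    (∀ b, (q b : EReal) ≤ f b) ∧ ∃ τ : ℝ, 0 < τ ∧ HasApprox τ f := by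
  obtain ⟨N, hN, hv⟩ := h
  obtain ⟨τ, hτ, h0, hb⟩ := hN.exists_bounds
  obtain ⟨h1, h2⟩ := (isVZWith_iff hbot (fun b => (gap_nonneg hτ b).trans (hb b).1) h0).1 hv
  refine ⟨h1, τ, hτ, fun c ε hε => ?_⟩
  obtain ⟨b, r, hr, hlt⟩ := h2 c ε hε
  exact ⟨b, r, hr, by linarith [(hb (c - b)).1]⟩

lemma exists_norm_le_one_apply_gt {X : Type*} [NormedAddCommGroup X] [NormedSpace ℝ X]
    (φ : StrongDual ℝ X) {δ : ℝ} (hδ : 0 < δ) : ∃ x, ‖x‖ ≤ 1 ∧ ‖φ‖ - δ < φ x := by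
  obtain ⟨x, hx1, hx2⟩ := φ.exists_lt_apply_of_lt_opNorm (r := ‖φ‖ - δ) (by linarith)
  rcases le_total 0 (φ x) with h0 | h0
  · exact ⟨x, hx1.le, by simpa [abs_of_nonneg h0] using hx2⟩
  · exact ⟨-x, by simpa using hx1.le, by simpa [abs_of_nonpos h0] using hx2⟩

/-- Almost-minimizers give `f* ≥ q̃` on `E** × E*`: at `(y**, y*)` one tests with `c = (0, y* - v)`,
where `v ∈ E*` almost attains `-‖y**‖ ‖v‖` and has norm at most `τ²‖y**‖`. -/
lemma HasApprox.isMAS {f : Phase E → EReal} {τ : ℝ} (hτ : 0 < τ)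
    (hq : ∀ b, (q b : EReal) ≤ f b) (h : HasApprox τ f) : IsMAS f := by
  refine ⟨hq, fun d => ?_⟩
  refine EReal.ge_of_forall_gt_iff_ge.1 fun z hz => ?_
  have hz' : z < d.1 d.2 := by exact_mod_cast hz
  obtain ⟨v, hv1, hv2⟩ : ∃ v : StrongDual ℝ E, ‖v‖ ≤ τ ^ 2 * ‖d.1‖ ∧
      τ ^ 2 * ‖d.1‖ ^ 2 + d.1 v < (d.1 d.2 - z) / 2 := by
    by_cases hd : ‖d.1‖ = 0
    · exact ⟨0, by rw [hd]; simp, by rw [hd]; simpa using hz'⟩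
    have hdn : 0 < ‖d.1‖ := d.1.opNorm_nonneg.lt_of_ne' hd
    set δ := (d.1 d.2 - z) / 2 with hδ
    have hδ0 : 0 < δ := by rw [hδ]; linarith
    obtain ⟨w, hw1, hw2⟩ := exists_norm_le_one_apply_gt d.1
      (show 0 < δ / (2 * (τ ^ 2 * ‖d.1‖)) by positivity)
    refine ⟨-((τ ^ 2 * ‖d.1‖) • w), ?_, ?_⟩
    · rw [norm_neg, norm_smul, Real.norm_of_nonneg (by positivity)]
      exact mul_le_of_le_one_right (by positivity) hw1
    · rw [map_neg, map_smul, smul_eq_mul]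
      have h1 := mul_lt_mul_of_pos_left hw2 (show 0 < τ ^ 2 * ‖d.1‖ by positivity)
      have h2 : τ ^ 2 * ‖d.1‖ * (‖d.1‖ - δ / (2 * (τ ^ 2 * ‖d.1‖)))
          = τ ^ 2 * ‖d.1‖ ^ 2 - δ / 2 := by field_simp
      linarith
  obtain ⟨b, r, hr, hlt⟩ := h (0, d.2 - v) ((d.1 d.2 - z) / 2) (by linarith)
  refine le_trans ?_ (le_iSup _ b)
  rw [hr]
  norm_cast
  -- the pairing of `(y**, v)` with `c - b` is estimated by Young's inequality
  have h1 := d.1.le_opNorm (d.2 - v - b.2)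
  have h2 := v.le_opNorm b.1
  have h1' := (le_of_abs_le ((Real.norm_eq_abs _) ▸ h1))
  have h2' := (neg_le_of_abs_le ((Real.norm_eq_abs _) ▸ h2))
  have h3 : ‖v‖ * ‖b.1‖ ≤ τ ^ 2 * ‖d.1‖ * ‖b.1‖ :=
    mul_le_mul_of_nonneg_right hv1 (norm_nonneg _)
  have h4 : wsum τ ((0, d.2 - v) - b) = τ * ‖b.1‖ + ‖d.2 - v - b.2‖ / τ := by
    simp [wsum]
  have h5 : τ * ‖d.1‖ * wsum τ ((0, d.2 - v) - b)
      = τ ^ 2 * ‖d.1‖ * ‖b.1‖ + ‖d.1‖ * ‖d.2 - v - b.2‖ := by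
    rw [h4]; field_simp
  have h6 := sq_nonneg (τ * ‖d.1‖ - wsum τ ((0, d.2 - v) - b) / 2)
  have h7 : q ((0, d.2 - v) - b) = - (d.2 b.1 - v b.1) + q b := by
    rw [q_sub]; simp [q]
  have h8 : d.1 (d.2 - v - b.2) = d.1 d.2 - d.1 v - d.1 b.2 := by simp
  unfold gap at hlt
  rw [h7] at hlt
  rw [h8] at h1'
  linarith

/-! ### Duality: MAS functions are VZ functions -/

/-- Sandwich theorem: a continuous affine function fits between a concave continuous function
and a proper convex function that dominates it. -/
lemma exists_affine_between {X : Type*} [NormedAddCommGroup X] [NormedSpace ℝ X]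
    {f : X → EReal} (hf : IsProperConvex f) {h : X → ℝ} (hc : Continuous h)
    (hconc : ConcaveOn ℝ Set.univ h) (hle : ∀ b, (h b : EReal) ≤ f b) :
    ∃ (φ : StrongDual ℝ X) (r : ℝ), (∀ b, h b ≤ φ b + r) ∧
      ∀ b, ((φ b + r : ℝ) : EReal) ≤ f b := by
  have hS1 : Convex ℝ {p : X × ℝ | p.2 < h p.1} := by
    have := hconc.convex_strict_hypograph
    simpa using this
  have hS2 : IsOpen {p : X × ℝ | p.2 < h p.1} :=
    isOpen_lt continuous_snd (hc.comp continuous_fst)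
  have hT : Convex ℝ {p : X × ℝ | f p.1 ≤ p.2} := by
    rw [convex_iff_forall_pos]
    rintro ⟨b, x⟩ hb ⟨c, y⟩ hc s t hs ht hst
    simp only [Set.mem_ofPred_eq] at hb hc ⊢
    refine (hf.convex b c s t hs ht hst).trans ?_
    have h1 : (s : EReal) * f b ≤ s * x :=
      mul_le_mul_of_nonneg_left hb (by exact_mod_cast hs.le)
    have h2 : (t : EReal) * f c ≤ t * y :=
      mul_le_mul_of_nonneg_left hc (by exact_mod_cast ht.le)
    refine (add_le_add h1 h2).trans (le_of_eq ?_)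
    simp
  have hd : Disjoint {p : X × ℝ | p.2 < h p.1} {p : X × ℝ | f p.1 ≤ p.2} := by
    rw [Set.disjoint_left]
    rintro ⟨b, x⟩ h1 h2
    have h3 : (h b : EReal) ≤ x := (hle b).trans h2
    exact absurd h1 (not_lt.2 (by exact_mod_cast h3))
  obtain ⟨L, u, hL1, hL2⟩ := geometric_hahn_banach_open hS1 hS2 hT hd
  have hsplit : ∀ b x, L (b, x) = L (b, 0) + x * L (0, 1) := fun b x => by
    have : ((b, x) : X × ℝ) = (b, 0) + x • (0, 1) := by ext <;> simp
    rw [this, map_add, map_smul, smul_eq_mul]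
  obtain ⟨b₀, r₀, hb₀⟩ := hf.proper
  set l := L (0, 1) with hl
  -- the separating hyperplane is not vertical
  have hlpos : 0 < l := by
    have h1 := hL1 (b₀, h b₀ - 1) (by simp)
    have h2 := hL2 (b₀, r₀) (by simp [hb₀])
    have h3 : h b₀ ≤ r₀ := by have := hle b₀; rw [hb₀] at this; exact_mod_cast this
    rw [hsplit] at h1 h2
    have h4 : 0 < (r₀ - (h b₀ - 1)) * l := by linarith
    exact pos_of_mul_pos_right h4 (by linarith)
  refine ⟨(-l⁻¹) • (L.comp (ContinuousLinearMap.inl ℝ X ℝ)), u / l, fun b => ?_, fun b => ?_⟩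
  · refine le_of_forall_lt fun x hx => ?_
    have h1 := hL1 (b, x) hx
    rw [hsplit] at h1
    simp only [_root_.smul_apply, ContinuousLinearMap.comp_apply,
      ContinuousLinearMap.inl_apply, smul_eq_mul]
    have : -l⁻¹ * L (b, 0) + u / l = (u - L (b, 0)) / l := by field_simp; ring
    rw [this, lt_div_iff₀ hlpos]
    linarith
  · induction hfb : f b with
    | bot => exact absurd hfb (hf.ne_bot b)
    | top => exact le_top
    | coe x =>
      have h1 := hL2 (b, x) (by simp [hfb])
      rw [hsplit] at h1
      simp only [_root_.smul_apply, ContinuousLinearMap.comp_apply,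
        ContinuousLinearMap.inl_apply, smul_eq_mul]
      have : -l⁻¹ * L (b, 0) + u / l = (u - L (b, 0)) / l := by field_simp; ring
      rw [this]
      norm_cast
      rw [div_le_iff₀ hlpos]
      linarith

/-- Half the square of `‖·‖_{∞,τ}` is convex. -/
lemma convexOn_max_sq {τ : ℝ} (hτ : 0 < τ) :
    ConvexOn ℝ Set.univ fun b : Phase E => max (τ * ‖b.1‖) (‖b.2‖ / τ) ^ 2 := by
  have h1 : ConvexOn ℝ Set.univ fun b : Phase E => τ * ‖b.1‖ :=
    ((convexOn_univ_norm (E := E)).comp_linearMap (LinearMap.fst ℝ E (StrongDual ℝ E))).smul hτ.le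
  have h2 : ConvexOn ℝ Set.univ fun b : Phase E => ‖b.2‖ / τ := by
    have := ((convexOn_univ_norm (E := StrongDual ℝ E)).comp_linearMap
      (LinearMap.snd ℝ E (StrongDual ℝ E))).smul (inv_nonneg.2 hτ.le)
    refine this.congr fun b _ => ?_
    simp [div_eq_inv_mul]
  exact (h1.sup h2).pow (fun b _ => le_max_of_le_left (by positivity)) 2

/-- A MAS function is VZ for the largest special norm with parameter `τ`. If the infimum were
positive, an affine function could be inserted between `f` and a concave function, and the
corresponding point of `E** × E*` would violate `f* ≥ q̃`. -/
lemma IsMAS.exists_approx {f : Phase E → EReal} (hf : IsProperConvex f) (hm : IsMAS f)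
    {τ : ℝ} (hτ : 0 < τ) (c : Phase E) {ε : ℝ} (hε : 0 < ε) :
    ∃ b, ∃ r : ℝ, f b = r ∧
      r - q b + (max (τ * ‖(c - b).1‖) (‖(c - b).2‖ / τ) ^ 2 + q (c - b)) < ε := by
  by_contra! hcon
  obtain ⟨φ, r, hφ1, hφ2⟩ := exists_affine_between hf
    (h := fun b => ε - q c + (c.2 b.1 + b.2 c.1)
      - max (τ * ‖(c - b).1‖) (‖(c - b).2‖ / τ) ^ 2) (by fun_prop) (by
      refine ConcaveOn.sub ?_ ?_
      · refine ⟨convex_univ, fun x _ y _ s t _ _ hst => le_of_eq ?_⟩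
        simp only [smul_eq_mul, Prod.fst_add, Prod.snd_add, Prod.smul_fst, Prod.smul_snd, map_add,
          map_smul, _root_.add_apply, _root_.smul_apply]
        linear_combination (ε - q c) * hst
      · have := (convexOn_max_sq (E := E) hτ).comp_affineMap
          (AffineMap.const ℝ (Phase E) c - AffineMap.id ℝ (Phase E))
        refine this.congr fun b _ => ?_
        simp) (fun b => by
      induction hfb : f b with
      | bot => exact absurd hfb (hf.ne_bot b)
      | top => exact le_top
      | coe r =>
        have h1 := hcon b r hfb
        rw [q_sub c b] at h1
        norm_cast
        linarith)
  set D : StrongDual ℝ (StrongDual ℝ E) := φ.comp (ContinuousLinearMap.inr ℝ E (StrongDual ℝ E))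
    with hD
  set d : StrongDual ℝ E := φ.comp (ContinuousLinearMap.inl ℝ E (StrongDual ℝ E)) with hd
  have hφ : ∀ x w, φ (x, w) = d x + D w := fun x w => by
    have : ((x, w) : Phase E) = (x, 0) + (0, w) := by simp
    rw [this, map_add]; rfl
  have hconj : D d ≤ -r := by
    have h1 : conj f (D, d) ≤ ((-r : ℝ) : EReal) := by
      refine iSup_le fun b => ?_
      have h2 := hφ2 b
      induction hfb : f b with
      | bot => exact absurd hfb (hf.ne_bot b)
      | top => simp
      | coe s =>
        rw [hfb] at h2
        norm_cast at h2 ⊢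
        have := hφ b.1 b.2
        simp only [Prod.mk.eta] at this
        simp only
        linarith
    have h2 := (hm.2 (D, d)).trans h1
    exact_mod_cast h2
  set U : StrongDual ℝ (StrongDual ℝ E) := D - NormedSpace.inclusionInDoubleDual ℝ E c.1 with hU
  set v : StrongDual ℝ E := d - c.2 with hv
  set s := (‖v‖ / τ + τ * ‖U‖) / 2 with hs
  have hU0 : 0 ≤ ‖U‖ := U.opNorm_nonneg
  have hs0 : 0 ≤ s := by positivity
  set W := s * (1 / τ + τ) with hW
  have hW0 : 0 ≤ W := by positivity
  set δ := ε / (2 * (W + 1)) with hδ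
  have hδ0 : 0 < δ := by positivity
  obtain ⟨x, hx1, hx2⟩ := exists_norm_le_one_apply_gt v hδ0
  obtain ⟨w, hw1, hw2⟩ := exists_norm_le_one_apply_gt U hδ0
  -- test at `c - e`, where `e` almost attains the norm of `(U, v)`
  have h1 := hφ1 (c - ((s / τ) • x, (s * τ) • w))
  have h2 : max (τ * ‖(s / τ) • x‖) (‖(s * τ) • w‖ / τ) ^ 2 ≤ s ^ 2 := by
    refine pow_le_pow_left₀ (le_max_of_le_left (by positivity)) (max_le ?_ ?_) 2
    · rw [norm_smul, Real.norm_of_nonneg (by positivity)]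
      calc τ * (s / τ * ‖x‖) = s * ‖x‖ := by field_simp
        _ ≤ s := mul_le_of_le_one_right hs0 hx1
    · rw [norm_smul, Real.norm_of_nonneg (by positivity)]
      calc s * τ * ‖w‖ / τ = s * ‖w‖ := by field_simp
        _ ≤ s := mul_le_of_le_one_right hs0 hw1
  have h3 : s / τ * (‖v‖ - δ) ≤ s / τ * v x := mul_le_mul_of_nonneg_left hx2.le (by positivity)
  have h4 : s * τ * (‖U‖ - δ) ≤ s * τ * U w := mul_le_mul_of_nonneg_left hw2.le (by positivity)
  have h5 : s / τ * (‖v‖ - δ) + s * τ * (‖U‖ - δ) = 2 * s ^ 2 - W * δ := by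
    rw [hW, hs]; field_simp; ring
  have h6 : W * δ < ε := by
    rw [hδ, mul_div_assoc', div_lt_iff₀ (by positivity)]
    nlinarith
  have h7 : ‖v‖ * ‖U‖ ≤ s ^ 2 := by
    have : s ^ 2 = ‖v‖ * ‖U‖ + (‖v‖ / τ - τ * ‖U‖) ^ 2 / 4 := by
      rw [hs]; field_simp; ring
    rw [this]
    linarith [sq_nonneg (‖v‖ / τ - τ * ‖U‖)]
  have h8 : -(‖U‖ * ‖v‖) ≤ U v := neg_le_of_abs_le (U.le_opNorm v)
  have h9 : U v = D d - D c.2 - d c.1 + q c := by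
    simp [hU, hv, q]; ring
  have h10 : v x = d x - c.2 x := rfl
  have h11 : U w = D w - w c.1 := by simp [hU]
  rw [h10] at h3
  rw [h11] at h4
  simp only [sub_sub_cancel, Prod.fst_sub, Prod.snd_sub, map_sub, map_smul, smul_eq_mul,
    _root_.sub_apply, _root_.smul_apply] at h1
  have h12 : φ c = d c.1 + D c.2 := hφ c.1 c.2
  rw [h12, hφ, map_smul, map_smul, smul_eq_mul, smul_eq_mul] at h1
  have h13 : c.2 c.1 = q c := rfl
  rw [h13] at h1
  linarith

/-- A MAS function is VZ for `‖·‖_{1,τ}` for every `τ > 0`. -/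
lemma IsMAS.hasApprox {f : Phase E → EReal} (hf : IsProperConvex f) (hm : IsMAS f)
    {τ : ℝ} (hτ : 0 < τ) : HasApprox τ f := by
  intro c ε hε
  obtain ⟨b, r, hr, hlt⟩ := hm.exists_approx hf hτ c hε
  refine ⟨b, r, hr, lt_of_le_of_lt ?_ hlt⟩
  have h1 : wsum τ (c - b) ≤ 2 * max (τ * ‖(c - b).1‖) (‖(c - b).2‖ / τ) := by
    have h2 := le_max_left (τ * ‖(c - b).1‖) (‖(c - b).2‖ / τ)
    have h3 := le_max_right (τ * ‖(c - b).1‖) (‖(c - b).2‖ / τ)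
    unfold wsum
    linarith
  have h2 := pow_le_pow_left₀ (wsum_nonneg hτ _) h1 2
  unfold gap
  linarith

lemma IsMAS.isVZWith {f : Phase E → EReal} (hf : IsProperConvex f) (hm : IsMAS f)
    {N : Phase E → ℝ} (hN : IsSpecialNorm N) : IsVZWith N f := by
  obtain ⟨τ, hτ, h0, hb⟩ := hN.exists_bounds
  refine (isVZWith_iff hf.ne_bot (fun b => (gap_nonneg hτ b).trans (hb b).1) h0).2
    ⟨hm.1, fun c ε hε => ?_⟩
  obtain ⟨b, r, hr, hlt⟩ := hm.exists_approx hf hτ c hε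
  exact ⟨b, r, hr, by linarith [(hb (c - b)).2]⟩

/-! ### Approximation by points of `M f` -/

/-- Convexity of `f` together with `q ≤ f`, tested at a convex combination of `b` and `c`. -/
lemma neg_mul_q_sub_le {f : Phase E → EReal} (hf : IsProperConvex f)
    (hq : ∀ b, (q b : EReal) ≤ f b) {b c : Phase E} {r s : ℝ} (hb : f b = r) (hc : f c = s)
    {l m : ℝ} (hl : 0 < l) (hm : 0 < m) (hlm : l + m = 1) :
    -(l * m * q (b - c)) ≤ l * (r - q b) + m * (s - q c) := by
  have h1 := (hq _).trans (hf.convex b c l m hl hm hlm)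
  rw [hb, hc] at h1
  norm_cast at h1
  obtain rfl : m = 1 - l := by linarith
  have h2 : q (l • b + (1 - l) • c) = l * q b + (1 - l) * q c - l * (1 - l) * q (b - c) := by
    simp [q]; ring
  linarith

lemma neg_q_sub_le_two_mul {f : Phase E → EReal} (hf : IsProperConvex f)
    (hq : ∀ b, (q b : EReal) ≤ f b) {b c : Phase E} {r s : ℝ} (hb : f b = r) (hc : f c = s) :
    -q (b - c) ≤ 2 * ((r - q b) + (s - q c)) := by
  have := neg_mul_q_sub_le hf hq hb hc (l := 1 / 2) (m := 1 / 2) (by norm_num) (by norm_num)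
    (by norm_num)
  linarith

lemma neg_q_sub_le_of_mem_M {f : Phase E → EReal} (hf : IsProperConvex f)
    (hq : ∀ b, (q b : EReal) ≤ f b) {b c : Phase E} {s : ℝ} (hb : b ∈ M f) (hc : f c = s) :
    -q (b - c) ≤ s - q c := by
  have hc0 : 0 ≤ s - q c := by
    have := hq c
    rw [hc] at this
    norm_cast at this
    linarith
  by_contra! hlt
  set Q := -q (b - c) with hQ
  have hQ0 : 0 < Q := by linarith
  -- the weight of `b` is chosen as `l` with `s - q c < l Q < Q`
  set l := ((s - q c) + Q) / (2 * Q) with hl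
  have hl0 : 0 < l := by positivity
  have hl1 : l < 1 := by rw [hl, div_lt_one (by positivity)]; linarith
  have h1 := neg_mul_q_sub_le hf hq hb hc hl0 (sub_pos.2 hl1) (by ring)
  have h2 : l * Q = ((s - q c) + Q) / 2 := by rw [hl]; field_simp
  have h3 : (1 - l) * (l * Q) ≤ (1 - l) * (s - q c) := by
    rw [hQ]; linarith
  have h4 := le_of_mul_le_mul_left h3 (sub_pos.2 hl1)
  linarith

lemma isMonotone_M {f : Phase E → EReal} (hf : IsProperConvex f)
    (hq : ∀ b, (q b : EReal) ≤ f b) : IsMonotone (M f) := fun b hb c hc => by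
  have := neg_q_sub_le_of_mem_M hf hq hb hc
  linarith

/-- Lower semicontinuity passes `f(bₙ) - q(bₙ) ≤ εₙ → 0` to the limit. -/
lemma mem_M_of_tendsto {f : Phase E → EReal} (hlsc : LowerSemicontinuous f)
    (hq : ∀ b, (q b : EReal) ≤ f b) {b : ℕ → Phase E} {a : Phase E} {r ε : ℕ → ℝ}
    (hb : Tendsto b atTop (𝓝 a)) (hr : ∀ n, f (b n) = r n) (hle : ∀ n, r n - q (b n) ≤ ε n)
    (hε : Tendsto ε atTop (𝓝 0)) : a ∈ M f := by
  refine le_antisymm ?_ (hq a)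
  by_contra! hlt
  obtain ⟨z, hz1, hz2⟩ := EReal.lt_iff_exists_real_btwn.1 hlt
  have h1 : ∀ᶠ n in atTop, (z : EReal) < f (b n) := hb.eventually (hlsc a z hz2)
  have h2 : Tendsto (fun n => q (b n) + ε n) atTop (𝓝 (q a + 0)) :=
    ((continuous_q.tendsto a).comp hb).add hε
  have h3 : z ≤ q a + 0 := by
    refine ge_of_tendsto h2 (h1.mono fun n hn => ?_)
    rw [hr] at hn
    norm_cast at hn
    linarith [hle n]
  norm_cast at hz1
  linarith

lemma isClosed_M {f : Phase E → EReal} (hlsc : LowerSemicontinuous f)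
    (hq : ∀ b, (q b : EReal) ≤ f b) : IsClosed (M f) := by
  refine isClosed_of_closure_subset fun a ha => ?_
  obtain ⟨b, hb, hlim⟩ := mem_closure_iff_seq_limit.1 ha
  exact mem_M_of_tendsto hlsc hq hlim hb (fun n => (sub_self _).le) tendsto_const_nhds

/-- A point at which `f - q` is at most `ε` lies within a multiple of `√ε` of `M f`. Almost
minimizers are iterated, each taken at the previous one, with tolerances `ε/4ⁿ`; monotonicity-type
estimates turn smallness of `p` into smallness of the norm, so that the sequence is Cauchy. -/
lemma HasApprox.exists_mem_M_dist_le [CompleteSpace E] {f : Phase E → EReal} (hf : IsPCLSC f)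
    (hq : ∀ b, (q b : EReal) ≤ f b) {τ : ℝ} (hτ : 0 < τ) (h : HasApprox τ f) {b : Phase E}
    {r ε : ℝ} (hb : f b = r) (hε : 0 < ε) (hr : r - q b ≤ ε) :
    ∃ a ∈ M f, dist b a ≤ 8 * (τ + τ⁻¹) * √ε := by
  have step : ∀ (n : ℕ) (p : {p : Phase E × ℝ // f p.1 = p.2 ∧ p.2 - q p.1 ≤ ε / 4 ^ n}),
      ∃ p' : {p : Phase E × ℝ // f p.1 = p.2 ∧ p.2 - q p.1 ≤ ε / 4 ^ (n + 1)},
        dist p.1.1 p'.1.1 ≤ 8 * (τ + τ⁻¹) * √ε / 2 / 2 ^ n := by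
    rintro n ⟨⟨x, r⟩, hx, hxr⟩
    simp only at hx hxr
    obtain ⟨y, s, hy, hlt⟩ := h x (ε / 4 ^ (n + 1)) (by positivity)
    have hys : 0 ≤ s - q y := by
      have := hq y
      rw [hy] at this
      norm_cast at this
      linarith
    have hg := gap_nonneg hτ (x - y)
    refine ⟨⟨(y, s), hy, by simp only; linarith⟩, ?_⟩
    have h1 := neg_q_sub_le_two_mul hf.1 hq hx hy
    have h2 : ε / 4 ^ (n + 1) = ε / 4 ^ n / 4 := by rw [pow_succ]; field_simp
    have h3 : wsum τ (x - y) ^ 2 ≤ (4 * (√ε / 2 ^ n)) ^ 2 := by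
      have : (4 * (√ε / 2 ^ n)) ^ 2 = 16 * (ε / 4 ^ n) := by
        rw [mul_pow, div_pow, Real.sq_sqrt hε.le, ← pow_mul, mul_comm n 2, pow_mul]
        norm_num
      rw [this]
      unfold gap at hlt hg
      rw [h2] at hlt
      have h5 : 0 < ε / 4 ^ n := by positivity
      linarith
    have h4 := abs_le_of_sq_le_sq h3 (by positivity)
    rw [dist_eq_norm]
    refine (norm_le_wsum hτ _).trans ?_
    have h6 := mul_le_mul_of_nonneg_left (le_of_abs_le h4) (show 0 ≤ τ + τ⁻¹ by positivity)
    refine h6.trans (le_of_eq ?_)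
    ring
  choose F hF using step
  let u : ∀ n : ℕ, {p : Phase E × ℝ // f p.1 = p.2 ∧ p.2 - q p.1 ≤ ε / 4 ^ n} := fun n =>
    Nat.rec ⟨(b, r), hb, by simpa using hr⟩ (fun n p => F n p) n
  have hu : ∀ n, dist (u n).1.1 (u (n + 1)).1.1 ≤ 8 * (τ + τ⁻¹) * √ε / 2 / 2 ^ n :=
    fun n => hF n (u n)
  obtain ⟨a, ha⟩ := cauchySeq_tendsto_of_complete (cauchySeq_of_le_geometric_two hu)
  refine ⟨a, ?_, dist_le_of_le_geometric_two_of_tendsto₀ hu ha⟩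
  refine mem_M_of_tendsto hf.2 hq ha (fun n => (u n).2.1) (fun n => (u n).2.2) ?_
  exact tendsto_const_nhds.div_atTop (tendsto_pow_atTop_atTop_of_one_lt (by norm_num))

lemma HasApprox.nonempty_M [CompleteSpace E] {f : Phase E → EReal} (hf : IsPCLSC f)
    (hq : ∀ b, (q b : EReal) ≤ f b) {τ : ℝ} (hτ : 0 < τ) (h : HasApprox τ f) :
    (M f).Nonempty := by
  obtain ⟨b, r, hr⟩ := hf.1.proper
  obtain ⟨a, ha, -⟩ := h.exists_mem_M_dist_le hf hq hτ hr (ε := max (r - q b) 1)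
    (by positivity) (le_max_left _ _)
  exact ⟨a, ha⟩

/-- The infimum of `p(· - c)` over `M f` is zero, along a bounded sequence. -/
lemma HasApprox.exists_seq [CompleteSpace E] {f : Phase E → EReal} (hf : IsPCLSC f)
    (hq : ∀ b, (q b : EReal) ≤ f b) {τ : ℝ} (hτ : 0 < τ) (h : HasApprox τ f) (c : Phase E) :
    ∃ y : ℕ → Phase E, Bornology.IsBounded (Set.range y) ∧ (∀ n, y n ∈ M f) ∧
      Tendsto (fun n => gap τ (y n - c)) atTop (𝓝 0) := by
  obtain ⟨a, ha⟩ := h.nonempty_M hf hq hτ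
  have hstep : ∀ n : ℕ, ∃ b, ∃ r : ℝ, f b = r ∧ r - q b + gap τ (c - b) < 1 / ((n : ℝ) + 1) :=
    fun n => h c _ (by positivity)
  choose b r hr hlt using hstep
  have hle1 : ∀ n : ℕ, 1 / ((n : ℝ) + 1) ≤ 1 := fun n => by
    rw [div_le_one (by positivity)]; simp
  have hrq : ∀ n, 0 ≤ r n - q (b n) := fun n => by
    have := hq (b n)
    rw [hr] at this
    norm_cast at this
    linarith
  choose y hy hyd using fun n => h.exists_mem_M_dist_le hf hq hτ (hr n)
    (show 0 < 1 / ((n : ℝ) + 1) by positivity) (by linarith [hlt n, gap_nonneg hτ (c - b n)])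
  -- `bₙ - c` is bounded because `q (a - bₙ)` is bounded below
  set W := wsum τ (c - a) with hW
  have hW0 : 0 ≤ W := wsum_nonneg hτ _
  have hbd : ∀ n, wsum τ (c - b n) ≤ 4 * W + 4 * |q (c - a)| + 13 := fun n => by
    have h1 := neg_q_sub_le_two_mul hf.1 hq ha (hr n)
    have h2 : q (a - b n) = q (c - b n) - ((c - b n).2 (c - a).1 + (c - a).2 (c - b n).1)
        + q (c - a) := by
      rw [← q_sub]; congr 1; abel
    have h3 := neg_le_of_abs_le (abs_polar_le hτ (c - b n) (c - a))
    have h4 := hlt n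
    have h5 := hle1 n
    have h6 := gap_nonneg hτ (c - b n)
    have h7 := le_abs_self (q (c - a))
    have h8 := abs_nonneg (q (c - a))
    have h9 := hrq n
    unfold gap at h4 h6
    set s := wsum τ (c - b n) with hs
    have h10 : s ^ 2 ≤ 4 * (W * s) + 4 * |q (c - a)| + 12 := by linarith
    by_contra! hcon
    have h11 : 0 ≤ W * s := by apply mul_nonneg hW0; linarith
    nlinarith
  set K := 4 * W + 4 * |q (c - a)| + 13 with hK
  have hK0 : 0 ≤ K := by positivity
  have he : Tendsto (fun n => wsum τ (y n - b n)) atTop (𝓝 0) := by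
    have h1 : Tendsto (fun n : ℕ => (τ + τ⁻¹) * (8 * (τ + τ⁻¹) * √(1 / ((n : ℝ) + 1)))) atTop
        (𝓝 ((τ + τ⁻¹) * (8 * (τ + τ⁻¹) * √0))) :=
      ((((Real.continuous_sqrt.tendsto 0).comp
        tendsto_one_div_add_atTop_nhds_zero_nat).const_mul _).const_mul _)
    rw [Real.sqrt_zero, mul_zero, mul_zero] at h1
    refine squeeze_zero (fun n => wsum_nonneg hτ _) (fun n => ?_) h1
    refine (wsum_le_norm hτ _).trans (mul_le_mul_of_nonneg_left ?_ (by positivity))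
    rw [← dist_eq_norm, dist_comm]
    exact hyd n
  refine ⟨y, ?_, hy, ?_⟩
  · refine (Metric.isBounded_iff_subset_closedBall c).2
      ⟨8 * (τ + τ⁻¹) + (τ + τ⁻¹) * K, ?_⟩
    rintro _ ⟨n, rfl⟩
    rw [Metric.mem_closedBall]
    refine (dist_triangle _ (b n) _).trans (add_le_add ?_ ?_)
    · rw [dist_comm]
      refine (hyd n).trans (mul_le_of_le_one_right (by positivity) ?_)
      exact Real.sqrt_le_one.2 (hle1 n)
    · rw [dist_comm, dist_eq_norm]
      exact (norm_le_wsum hτ _).trans (mul_le_mul_of_nonneg_left (hbd n) (by positivity))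
  · have hneg : ∀ n, wsum τ (b n - c) = wsum τ (c - b n) := fun n => by
      simp only [wsum, Prod.fst_sub, Prod.snd_sub, norm_sub_rev]
    have h1 : Tendsto (fun n : ℕ => 1 / ((n : ℝ) + 1) + 3 / 2 * (K * wsum τ (y n - b n))
        + wsum τ (y n - b n) ^ 2 / 2) atTop (𝓝 (0 + 3 / 2 * (K * 0) + 0 ^ 2 / 2)) :=
      (tendsto_one_div_add_atTop_nhds_zero_nat.add ((he.const_mul K).const_mul _)).add
        ((he.pow 2).div_const 2)
    norm_num at h1
    refine squeeze_zero (fun n => gap_nonneg hτ _) (fun n => ?_) h1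
    have h2 : y n - c = (b n - c) + (y n - b n) := by abel
    rw [h2]
    refine (gap_add_le hτ _ _).trans ?_
    have h3 : gap τ (b n - c) = gap τ (c - b n) := by
      unfold gap; rw [hneg, q_sub_comm]
    have h4 := mul_le_mul_of_nonneg_right (hbd n) (wsum_nonneg hτ (y n - b n))
    rw [h3, hneg]
    have h5 := hlt n
    have h6 := hrq n
    rw [one_div] at h5
    linarith

lemma HasApprox.isMaximallyMonotone_M [CompleteSpace E] {f : Phase E → EReal} (hf : IsPCLSC f)
    (hq : ∀ b, (q b : EReal) ≤ f b) {τ : ℝ} (hτ : 0 < τ) (h : HasApprox τ f) :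
    IsMaximallyMonotone (M f) := by
  refine ⟨isMonotone_M hf.1 hq, fun A hA hMA c hc => ?_⟩
  obtain ⟨y, -, hy, hlim⟩ := h.exists_seq hf hq hτ c
  have h1 : Tendsto (fun n => wsum τ (y n - c)) atTop (𝓝 0) := by
    have h2 := (hlim.const_mul 4).sqrt
    rw [mul_zero, Real.sqrt_zero] at h2
    refine squeeze_zero (fun n => wsum_nonneg hτ _) (fun n => Real.le_sqrt_of_sq_le ?_) h2
    have := hA (y n) (hMA (hy n)) c hc
    unfold gap
    linarith
  have h2 : Tendsto y atTop (𝓝 c) := by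
    rw [tendsto_iff_norm_sub_tendsto_zero]
    refine squeeze_zero (fun n => norm_nonneg _) (fun n => norm_le_wsum hτ _) ?_
    simpa using h1.const_mul (τ + τ⁻¹)
  exact (isClosed_M hf.2 hq).mem_of_tendsto h2 (Eventually.of_forall hy)

/-! ### Negatively aligned sequences -/

/-- `y` is a bounded sequence in `A` with `‖yₙ - x‖ → αω`, `‖yₙ* - x*‖ → βω` and
`⟨yₙ - x, yₙ* - x*⟩ → -αβω²`, where `c = (x, x*)`. -/
structure IsNegAlignedAt (A : Set (Phase E)) (c : Phase E) (α β ω : ℝ) (y : ℕ → Phase E) :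
    Prop where
  bounded : Bornology.IsBounded (Set.range y)
  mem : ∀ n, y n ∈ A
  fst : Tendsto (fun n => ‖(y n).1 - c.1‖) atTop (𝓝 (α * ω))
  snd : Tendsto (fun n => ‖(y n).2 - c.2‖) atTop (𝓝 (β * ω))
  pairing : Tendsto (fun n => q (y n - c)) atTop (𝓝 (-(α * β * ω ^ 2)))

/-- A sequence along which `p` tends to zero, for the parameter `τ = √(β/α)`, has a subsequence
along which `τ‖yₙ - x‖` and `‖yₙ* - x*‖/τ` converge; the limits agree because their difference
is controlled by `p`. -/
lemma HasApprox.exists_isNegAlignedAt [CompleteSpace E] {f : Phase E → EReal} (hf : IsPCLSC f)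
    (hq : ∀ b, (q b : EReal) ≤ f b) {α β : ℝ} (hα : 0 < α) (hβ : 0 < β)
    (h : HasApprox (√β / √α) f) (c : Phase E) :
    ∃ ω : ℝ, 0 ≤ ω ∧ ∃ y, IsNegAlignedAt (M f) c α β ω y := by
  have ha : 0 < √α := Real.sqrt_pos.2 hα
  have hb : 0 < √β := Real.sqrt_pos.2 hβ
  have ha2 : √α ^ 2 = α := Real.sq_sqrt hα.le
  have hb2 : √β ^ 2 = β := Real.sq_sqrt hβ.le
  set a := √α
  set b := √β
  have hτ : 0 < b / a := by positivity
  obtain ⟨y, hbd, hy, hlim⟩ := h.exists_seq hf hq hτ c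
  obtain ⟨R, hR⟩ := (Metric.isBounded_iff_subset_closedBall c).1 hbd
  have hs : ∀ n, wsum (b / a) (y n - c) ∈ Set.Icc 0 ((b / a + (b / a)⁻¹) * R) := fun n => by
    refine ⟨wsum_nonneg hτ _, (wsum_le_norm hτ _).trans
      (mul_le_mul_of_nonneg_left ?_ (by positivity))⟩
    have := hR ⟨n, rfl⟩
    rwa [Metric.mem_closedBall, dist_eq_norm] at this
  obtain ⟨S, hS, k, hk, hkS⟩ := isCompact_Icc.tendsto_subseq hs
  have hgap := hlim.comp hk.tendsto_atTop
  have hdiff : Tendsto (fun n => b / a * ‖(y (k n) - c).1‖ - ‖(y (k n) - c).2‖ / (b / a))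
      atTop (𝓝 0) := by
    have h1 := (hgap.const_mul 4).sqrt
    rw [mul_zero, Real.sqrt_zero] at h1
    refine squeeze_zero_norm (fun n => ?_) h1
    rw [Real.norm_eq_abs, ← Real.sqrt_sq_eq_abs]
    refine Real.sqrt_le_sqrt ?_
    have := sub_sq_le_gap hτ (y (k n) - c)
    simp only [Function.comp_apply]
    linarith
  refine ⟨S / (2 * (a * b)), div_nonneg hS.1 (by positivity), fun n => y (k n),
    hbd.subset (Set.range_comp_subset_range k y), fun n => hy _, ?_, ?_, ?_⟩
  · have h1 := ((hkS.add hdiff).const_mul (a / (2 * b)))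
    convert h1 using 2
    · simp only [Function.comp_apply, wsum, Prod.fst_sub, Prod.snd_sub]
      field_simp; ring
    · rw [← ha2]; field_simp; ring
  · have h1 := ((hkS.sub hdiff).const_mul (b / (2 * a)))
    convert h1 using 2
    · simp only [Function.comp_apply, wsum, Prod.fst_sub, Prod.snd_sub]
      field_simp; ring
    · rw [← hb2]; field_simp; ring
  · have h1 := hgap.sub ((hkS.pow 2).div_const 4)
    convert h1 using 2
    · simp only [Function.comp_apply, gap]; ring
    · rw [← ha2, ← hb2]; field_simp; ring

/-- Monotonicity makes `ω` unique: for two sequences the pairings of the differences are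
nonnegative, while their limit superior is at most `-αβ(ω - ω')²`. -/
lemma IsNegAlignedAt.eq {A : Set (Phase E)} (hA : IsMonotone A) {c : Phase E} {α β ω ω' : ℝ}
    (hα : 0 < α) (hβ : 0 < β) {y z : ℕ → Phase E} (hy : IsNegAlignedAt A c α β ω y)
    (hz : IsNegAlignedAt A c α β ω' z) : ω = ω' := by
  have h1 := (hy.pairing.add hz.pairing).add
    ((hy.fst.mul hz.snd).add (hz.fst.mul hy.snd))
  have h2 := ge_of_tendsto' (b := 0) h1 fun n => by
    have e : y n - z n = (y n - c) - (z n - c) := by abel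
    have h3 := hA _ (hy.mem n) _ (hz.mem n)
    rw [e, q_sub] at h3
    have h4 := neg_le_of_abs_le ((y n - c).2.le_opNorm (z n - c).1)
    have h5 := neg_le_of_abs_le ((z n - c).2.le_opNorm (y n - c).1)
    simp only [Prod.fst_sub, Prod.snd_sub] at h3 h4 h5
    linarith
  have h3 : α * β * (ω - ω') ^ 2 ≤ 0 := by linarith
  have h4 : (ω - ω') ^ 2 ≤ 0 := nonpos_of_mul_nonpos_right h3 (by positivity)
  exact sub_eq_zero.1 (pow_eq_zero_iff two_ne_zero |>.1 (le_antisymm h4 (sq_nonneg _)))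

lemma IsNegAlignedAt.pos {A : Set (Phase E)} (hA : IsClosed A) {c : Phase E} (hc : c ∉ A)
    {α β ω : ℝ} (hω : 0 ≤ ω) {y : ℕ → Phase E} (hy : IsNegAlignedAt A c α β ω y) : 0 < ω := by
  refine hω.lt_of_ne' ?_
  rintro rfl
  have h1 := hy.fst
  have h2 := hy.snd
  rw [mul_zero, ← tendsto_iff_norm_sub_tendsto_zero] at h1 h2
  have h3 : Tendsto y atTop (𝓝 c) := h1.prodMk_nhds h2
  exact hc (hA.mem_of_tendsto h3 (Eventually.of_forall hy.mem))

/-- For `ω > 0` a tail of the sequence avoids `x` and `x*`, and the quotients converge. -/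
lemma IsNegAlignedAt.exists_isNegAligned {A : Set (Phase E)} {c : Phase E} {α β ω : ℝ}
    (hα : 0 < α) (hβ : 0 < β) (hω : 0 < ω) {y : ℕ → Phase E}
    (hy : IsNegAlignedAt A c α β ω y) :
    ∃ z, IsNegAligned A c α β z ∧ IsNegAlignedAt A c α β ω z := by
  have h1 := hy.fst.eventually (lt_mem_nhds (show 0 < α * ω by positivity))
  have h2 := hy.snd.eventually (lt_mem_nhds (show 0 < β * ω by positivity))
  obtain ⟨m, hm⟩ := eventually_atTop.1 (h1.and h2)
  have hz : IsNegAlignedAt A c α β ω (fun n => y (n + m)) :=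
    ⟨hy.bounded.subset (Set.range_comp_subset_range (· + m) y), fun n => hy.mem _,
      hy.fst.comp (tendsto_add_atTop_nat m), hy.snd.comp (tendsto_add_atTop_nat m),
      hy.pairing.comp (tendsto_add_atTop_nat m)⟩
  refine ⟨_, ⟨hz.bounded, hz.mem, fun n => ?_, fun n => ?_, ?_, ?_⟩, hz⟩
  · exact sub_ne_zero.1 (norm_pos_iff.1 (hm (n + m) (Nat.le_add_left _ _)).1)
  · exact sub_ne_zero.1 (norm_pos_iff.1 (hm (n + m) (Nat.le_add_left _ _)).2)
  · have := hz.fst.div hz.snd (by positivity)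
    rwa [mul_div_mul_right _ _ hω.ne'] at this
  · have := hz.pairing.div (hz.fst.mul hz.snd) (by positivity)
    have e : -(α * β * ω ^ 2) / (α * ω * (β * ω)) = -1 := by field_simp
    rwa [e] at this

lemma IsNegAlignedAt.lt_one {A : Set (Phase E)} {c : Phase E} {α β ω : ℝ}
    (hα : 0 < α) (hβ : 0 < β) (hω : 0 ≤ ω) {y : ℕ → Phase E} (hy : IsNegAlignedAt A c α β ω y)
    (hinf : ((-(α * β) : ℝ) : EReal) < infQ A c) : ω < 1 := by
  obtain ⟨z, hz1, hz2⟩ := EReal.lt_iff_exists_real_btwn.1 hinf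
  have h1 : z ≤ -(α * β * ω ^ 2) := ge_of_tendsto' hy.pairing fun n => by
    have h2 : infQ A c ≤ (q (y n - c) : EReal) := iInf₂_le (y n) (hy.mem n)
    exact_mod_cast hz2.le.trans h2
  norm_cast at hz1
  have h2 : α * β * ω ^ 2 < α * β * 1 := by linarith
  have h3 := lt_of_mul_lt_mul_left h2 (by positivity)
  exact (sq_lt_one_iff₀ hω).1 h3

/-- The lower bound `⟨y - x, y* - x*⟩ ≥ q(c) - f(c)` on `M f`. -/
lemma lt_infQ_of_lt {f : Phase E → EReal} (hf : IsProperConvex f)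
    (hq : ∀ b, (q b : EReal) ≤ f b) {c : Phase E} {t : ℝ}
    (hc : f c < ((q c + t : ℝ) : EReal)) : ((-t : ℝ) : EReal) < infQ (M f) c := by
  induction hfc : f c with
  | bot => exact absurd hfc (hf.ne_bot c)
  | top => rw [hfc] at hc; exact absurd hc (by simp)
  | coe s =>
    rw [hfc] at hc
    norm_cast at hc
    refine lt_of_lt_of_le (b := ((q c - s : ℝ) : EReal)) (by norm_cast; linarith) ?_
    refine le_iInf₂ fun b hb => ?_
    have := neg_q_sub_le_of_mem_M hf hq hb hfc
    norm_cast
    linarith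

lemma convex_dom {X : Type*} [AddCommGroup X] [Module ℝ X] {f : X → EReal}
    (hf : IsProperConvex f) : Convex ℝ (dom f) := by
  rw [convex_iff_forall_pos]
  rintro b ⟨r, hr⟩ c ⟨s, hs⟩ l m hl hm hlm
  have h := hf.convex b c l m hl hm hlm
  rw [hr, hs] at h
  norm_cast at h
  induction hfb : f (l • b + m • c) with
  | bot => exact absurd hfb (hf.ne_bot _)
  | top => rw [hfb] at h; exact absurd (top_le_iff.1 h) (EReal.coe_ne_top _)
  | coe t => exact ⟨t, hfb⟩

/-- Type (BR) at the points of `dom f`, one of the two radii being arbitrarily small, makes the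
projections of `M f` dense in those of `dom f`. -/
lemma closure_image_M_eq {f : Phase E → EReal} (hf : IsProperConvex f)
    (hq : ∀ b, (q b : EReal) ≤ f b) (hBR : IsTypeBR (M f)) :
    closure (Prod.fst '' M f) = closure (Prod.fst '' dom f) ∧
      closure (Prod.snd '' M f) = closure (Prod.snd '' dom f) := by
  have hsub : M f ⊆ dom f := fun b hb => ⟨q b, hb⟩
  have hnear : ∀ c ∈ dom f, ∀ α β : ℝ, 0 < α → 0 < β → (f c).toReal - q c < α * β →
      ∃ b ∈ M f, ‖b.1 - c.1‖ < α ∧ ‖b.2 - c.2‖ < β := by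
    rintro c ⟨s, hs⟩ α β hα hβ hlt
    rw [hs, EReal.toReal_coe] at hlt
    refine hBR c α β hα hβ (lt_infQ_of_lt hf hq ?_)
    rw [hs]
    norm_cast
    linarith
  have hrad : ∀ (c : Phase E) (ε : ℝ), 0 < ε →
      (f c).toReal - q c < ε * ((|(f c).toReal - q c| + 1) / ε) := fun c ε hε => by
    rw [mul_div_cancel₀ _ hε.ne']
    linarith [le_abs_self ((f c).toReal - q c)]
  constructor
  · refine (closure_mono (Set.image_mono hsub)).antisymm (closure_minimal ?_ isClosed_closure)
    rintro _ ⟨c, hc, rfl⟩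
    refine Metric.mem_closure_iff.2 fun ε hε => ?_
    obtain ⟨b, hb, hlt, -⟩ := hnear c hc ε _ hε (by positivity) (hrad c ε hε)
    exact ⟨b.1, ⟨b, hb, rfl⟩, by rwa [dist_comm, dist_eq_norm]⟩
  · refine (closure_mono (Set.image_mono hsub)).antisymm (closure_minimal ?_ isClosed_closure)
    rintro _ ⟨c, hc, rfl⟩
    refine Metric.mem_closure_iff.2 fun ε hε => ?_
    obtain ⟨b, hb, -, hlt⟩ := hnear c hc ((|(f c).toReal - q c| + 1) / ε) ε
      (by positivity) hε
      (by rw [mul_comm]; exact hrad c ε hε)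
    exact ⟨b.2, ⟨b, hb, rfl⟩, by rwa [dist_comm, dist_eq_norm]⟩

end VZ

open VZ
theorem theorem5p5 {E : Type*} [NormedAddCommGroup E] [NormedSpace ℝ E] [CompleteSpace E]
    [Nontrivial E] (f : Phase E → EReal) (hf : IsPCLSC f) :
    -- the hypotheses "VZ for one special norm", "VZ for all special norms", "MAS" are equivalent
    ((IsVZ f ↔ IsMAS f) ∧ (IsVZ f ↔ ∀ N : Phase E → ℝ, IsSpecialNorm N → IsVZWith N f)) ∧
    (IsVZ f ∨ IsMAS f →
      -- (a)
      IsMaximallyMonotone (M f) ∧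
      -- (b)
      (∀ c : Phase E, ∀ α β : ℝ, 0 < α → 0 < β →
        ∃! ω : ℝ, 0 ≤ ω ∧ ∃ y : ℕ → Phase E,
          Bornology.IsBounded (Set.range y) ∧ (∀ n, y n ∈ M f) ∧
          Tendsto (fun n => ‖(y n).1 - c.1‖) atTop (𝓝 (α * ω)) ∧
          Tendsto (fun n => ‖(y n).2 - c.2‖) atTop (𝓝 (β * ω)) ∧
          Tendsto (fun n => q (y n - c)) atTop (𝓝 (-(α * β * ω ^ 2)))) ∧
      -- (c)
      (∀ c : Phase E, c ∉ M f → ∀ α β : ℝ, 0 < α → 0 < β →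
        ∃ y : ℕ → Phase E, IsNegAligned (M f) c α β y) ∧
      IsTypeANA (M f) ∧
      -- (d)
      (∀ c : Phase E, c ∉ M f → ∀ α β : ℝ, 0 < α → 0 < β →
        ((-(α * β) : ℝ) : EReal) < infQ (M f) c →
        ∃ y : ℕ → Phase E, IsNegAligned (M f) c α β y ∧
          ∃ ρ σ : ℝ, ρ < α ∧ σ < β ∧
            Tendsto (fun n => ‖(y n).1 - c.1‖) atTop (𝓝 ρ) ∧
            Tendsto (fun n => ‖(y n).2 - c.2‖) atTop (𝓝 σ)) ∧
      IsTypeBR (M f) ∧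
      -- (e)
      (∀ c : Phase E, c ∉ M f → ∀ α β : ℝ, 0 < α → 0 < β →
        f c < ((q c + α * β : ℝ) : EReal) →
        ∃ y : ℕ → Phase E, IsNegAligned (M f) c α β y ∧
          ∃ ρ σ : ℝ, ρ < α ∧ σ < β ∧
            Tendsto (fun n => ‖(y n).1 - c.1‖) atTop (𝓝 ρ) ∧
            Tendsto (fun n => ‖(y n).2 - c.2‖) atTop (𝓝 σ)) ∧
      -- (f)
      closure (Prod.fst '' M f) = closure (Prod.fst '' dom f) ∧
      closure (Prod.snd '' M f) = closure (Prod.snd '' dom f) ∧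
      Convex ℝ (closure (Prod.fst '' M f)) ∧
      Convex ℝ (closure (Prod.snd '' M f))) := by
  have hsome : ∃ N : Phase E → ℝ, IsSpecialNorm N := ⟨normOne 1, 1, one_pos, Or.inl rfl⟩
  have hVM : IsVZ f → IsMAS f := fun h => by
    obtain ⟨hq, τ, hτ, h'⟩ := h.hasApprox hf.1.ne_bot
    exact h'.isMAS hτ hq
  have hMV : IsMAS f → ∀ N : Phase E → ℝ, IsSpecialNorm N → IsVZWith N f :=
    fun h N hN => h.isVZWith hf.1 hN
  refine ⟨⟨⟨hVM, fun h => hsome.imp fun N hN => ⟨hN, hMV h N hN⟩⟩,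
    fun h => hMV (hVM h), fun h => hsome.imp fun N hN => ⟨hN, h N hN⟩⟩, fun h => ?_⟩
  have hm : IsMAS f := h.elim hVM id
  have hq := hm.1
  have hap : ∀ τ : ℝ, 0 < τ → HasApprox τ f := fun τ hτ => hm.hasApprox hf.1 hτ
  have hmono := isMonotone_M hf.1 hq
  have hclosed := isClosed_M hf.2 hq
  have hex : ∀ c : Phase E, ∀ α β : ℝ, 0 < α → 0 < β →
      ∃ ω : ℝ, 0 ≤ ω ∧ ∃ y, IsNegAlignedAt (M f) c α β ω y := fun c α β hα hβ =>
    (hap (√β / √α) (by positivity)).exists_isNegAlignedAt hf hq hα hβ c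
  have hD : ∀ c : Phase E, c ∉ M f → ∀ α β : ℝ, 0 < α → 0 < β →
      ((-(α * β) : ℝ) : EReal) < infQ (M f) c →
      ∃ y : ℕ → Phase E, IsNegAligned (M f) c α β y ∧
        ∃ ρ σ : ℝ, ρ < α ∧ σ < β ∧
          Tendsto (fun n => ‖(y n).1 - c.1‖) atTop (𝓝 ρ) ∧
          Tendsto (fun n => ‖(y n).2 - c.2‖) atTop (𝓝 σ) := by
    intro c hc α β hα hβ hinf
    obtain ⟨ω, hω, y, hy⟩ := hex c α β hα hβ
    obtain ⟨z, hz1, hz2⟩ := hy.exists_isNegAligned hα hβ (hy.pos hclosed hc hω)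
    have hω1 := hy.lt_one hα hβ hω hinf
    exact ⟨z, hz1, α * ω, β * ω, mul_lt_of_lt_one_right hα hω1,
      mul_lt_of_lt_one_right hβ hω1, hz2.fst, hz2.snd⟩
  have hC : ∀ c : Phase E, c ∉ M f → ∀ α β : ℝ, 0 < α → 0 < β →
      ∃ y : ℕ → Phase E, IsNegAligned (M f) c α β y := by
    intro c hc α β hα hβ
    obtain ⟨ω, hω, y, hy⟩ := hex c α β hα hβ
    obtain ⟨z, hz, -⟩ := hy.exists_isNegAligned hα hβ (hy.pos hclosed hc hω)
    exact ⟨z, hz⟩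
  have hBR : IsTypeBR (M f) := by
    intro c α β hα hβ hinf
    by_cases hc : c ∈ M f
    · exact ⟨c, hc, by simpa using hα, by simpa using hβ⟩
    · obtain ⟨y, hy, ρ, σ, hρ, hσ, h1, h2⟩ := hD c hc α β hα hβ hinf
      obtain ⟨n, hn⟩ := ((h1.eventually (gt_mem_nhds hρ)).and
        (h2.eventually (gt_mem_nhds hσ))).exists
      exact ⟨y n, hy.mem n, hn⟩
  obtain ⟨hcl1, hcl2⟩ := closure_image_M_eq hf.1 hq hBR
  have hconv := convex_dom hf.1
  refine ⟨(hap 1 one_pos).isMaximallyMonotone_M hf hq one_pos, ?_, hC, ?_, hD, hBR, ?_, hcl1,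
    hcl2, ?_, ?_⟩
  · intro c α β hα hβ
    obtain ⟨ω, hω, y, hy⟩ := hex c α β hα hβ
    refine ⟨ω, ⟨hω, y, hy.bounded, hy.mem, hy.fst, hy.snd, hy.pairing⟩, ?_⟩
    rintro ω' ⟨-, z, hz1, hz2, hz3, hz4, hz5⟩
    exact IsNegAlignedAt.eq hmono hα hβ ⟨hz1, hz2, hz3, hz4, hz5⟩ hy
  · intro c hc
    obtain ⟨y, hy⟩ := hC c hc 1 1 one_pos one_pos
    exact ⟨y, fun n => ⟨hy.mem n, hy.fst_ne n, hy.snd_ne n⟩, hy.aligned⟩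
  · exact fun c hc α β hα hβ hlt => hD c hc α β hα hβ (lt_infQ_of_lt hf.1 hq hlt)
  · rw [hcl1]
    exact (hconv.is_linear_image (LinearMap.fst ℝ E (StrongDual ℝ E)).isLinear).closure
  · rw [hcl2]
    exact (hconv.is_linear_image (LinearMap.snd ℝ E (StrongDual ℝ E)).isLinear).closure
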